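/- Let $\mu$ be a (infinite) regular cardinal. A $\mu$-ary language $L$ is a set of function and relation symbols, each with an arity that is an ordinal $<\mu$. A $\mu$-AEC is a class $K$ of $L$-structures, for some $\mu$-ary language $L=L(K)$, with a reflexive and transitive relation $\le_K$ on $K$ such that: * $M\le_K N$ implies that $M$ is a substructure of $N$; if $f:N\cong N'$ is an $L$-isomorphism and $N\in K$, then $N'\in K$, and if moreover $M\le_K N$, then $f(M)\in K$ and $f(M)\le_K N'$; * (coherence) if $M_0\le_K M_2$, $M_1\le_K M_2$ and $M_0$ is a substructure of $M_1$, then $M_0\le_K M_1$; * (Tarski–Vaught) if $I$ is a partially ordered set in which every subset of cardinality $<\mu$ has an upper bound, and $M_i\in K$ $(i\in I)$ satisfy $M_i\le_K M_j$ for $i<j$, then $\bigcup_{i}M_i\in K$ and $M_j\le_K\bigcup_{i}M_i$ for all $j$; and if $N\in K$ and $M_i\le_K N$ for all $i$, then $\bigcup_i M_i\le_K N$; * (Löwenheim–Skolem–Tarski) there is a cardinal $\kappa=\kappa^{<\mu}\ge |L|+\mu$ such that for all $M\in K$ and $A\subseteq |M|$ there is $N\le_K M$ with $A\subseteq |N|$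 and $\|N\|\le |A|^{<\mu}+\kappa$. The least such $\kappa$ is denoted $\mathrm{LS}(K)$. Write $K_\lambda$ for the class of structures in $K$ of cardinality $\lambda$, ordered by $\le_K$, and $I(\lambda,K)$ for the number of structures in $K$ of cardinality $\lambda$ up to isomorphism. $K_\lambda$ has the extension property for $\delta$-chains if for all $M_i\in K_\lambda$ $(i<\delta)$ with $M_i\le_K M_j$ for $i<j<\delta$ there is $N\in K_\lambda$ with $M_i\le_K N$ for all $i<\delta$. A $K$-embedding $M\to N$ is an isomorphism of $M$ onto some $N_0\le_K N$. $K$ has amalgamation in $\lambda$ if for all $M_0,M_1,M_2\in K_\lambda$ with $M_0\le_K M_1$ and $M_0\le_K M_2$ there are $N\in K_\lambda$ and $K$-embeddings $f_1:M_1\to N$, $f_2:M_2\to N$ that agree on $M_0$. **Theorem.** Let $K$ be a $\mu$-AEC and let $\lambda$ be a cardinal with $\lambda=\lambda^{<\mu}\ge\mathrm{LS}(K)$ and $$I(\lambda,K)=1\le I(\lambda^+,K)<2^{\lambda^+}.$$ Assume that 1. $K_\lambda$ has the extension property for $\delta$-chains for every $\delta<\lambda^+$, and 2. $\lambda=\lambda^{\mu}$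 and $2^{\lambda}=\lambda^+$. Then $K$ has amalgamation in $\lambda$. -/

import Mathlib

open Cardinal

universe u

/-- A `μ`-ary language: a set of function symbols and a set of relation symbols, each with an
arity which is an ordinal less than `μ`. -/
structure MuLanguage (μ : Cardinal.{u}) where
  Func : Type u
  Rel : Type u
  funcArity : Func → Ordinal.{u}
  relArity : Rel → Ordinal.{u}
  funcArity_lt : ∀ F, funcArity F < μ.ord
  relArity_lt : ∀ R, relArity R < μ.ord

/-- The number of symbols of the language. -/
def MuLanguage.size {μ : Cardinal.{u}} (L : MuLanguage μ) : Cardinal.{u} :=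
  #L.Func + #L.Rel

/-- An `L`-structure. Its universe `|M|` is a set, in the sense of the model `ZFSet` of ZFC; an
`n`-tuple (`n` an ordinal) is a function from the set of ordinals `< n` to the universe. -/
structure LStr {μ : Cardinal.{u}} (L : MuLanguage μ) where
  carrier : ZFSet.{u}
  func : ∀ F : L.Func, (Set.Iio (L.funcArity F) → carrier) → carrier
  rel : ∀ R : L.Rel, (Set.Iio (L.relArity R) → carrier) → Prop

namespace LStr

variable {μ : Cardinal.{u}} {L : MuLanguage μ}

/-- The cardinality of (the universe of) a structure. -/
noncomputable def card (M : LStr L) : Cardinal.{u} := M.carrier.card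

/-- `M` is a submodel (substructure) of `N`: the universe of `M` is a subset of that of `N`, and
the functions and relations of `M` are the restrictions of those of `N`. -/
structure IsSub (M N : LStr L) : Prop where
  subset : ∀ x ∈ M.carrier, x ∈ N.carrier
  func_eq : ∀ (F : L.Func) (a : Set.Iio (L.funcArity F) → M.carrier),
    (M.func F a : ZFSet.{u}) = N.func F (fun i => ⟨a i, subset _ (a i).2⟩)
  rel_iff : ∀ (R : L.Rel) (a : Set.Iio (L.relArity R) → M.carrier),
    M.rel R a ↔ N.rel R (fun i => ⟨a i, subset _ (a i).2⟩)

/-- `L`-isomorphisms. -/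
structure Iso (M N : LStr L) where
  toEquiv : M.carrier ≃ N.carrier
  map_func : ∀ (F : L.Func) (a : Set.Iio (L.funcArity F) → M.carrier),
    toEquiv (M.func F a) = N.func F (fun i => toEquiv (a i))
  map_rel : ∀ (R : L.Rel) (a : Set.Iio (L.relArity R) → M.carrier),
    M.rel R a ↔ N.rel R (fun i => toEquiv (a i))

/-- The identity isomorphism. -/
def Iso.refl (M : LStr L) : Iso M M where
  toEquiv := Equiv.refl _
  map_func _ _ := rfl
  map_rel _ _ := Iff.rfl

/-- The inverse of an isomorphism. -/
def Iso.symm {M N : LStr L} (f : Iso M N) : Iso N M where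
  toEquiv := f.toEquiv.symm
  map_func F a := by
    rw [Equiv.symm_apply_eq, f.map_func]
    simp
  map_rel R a := by
    rw [f.map_rel]
    simp

/-- The composition of two isomorphisms. -/
def Iso.trans {M N P : LStr L} (f : Iso M N) (g : Iso N P) : Iso M P where
  toEquiv := f.toEquiv.trans g.toEquiv
  map_func F a := by simp [f.map_func, g.map_func]
  map_rel R a := by simp [f.map_rel, g.map_rel]

theorem Iso.card_eq {M N : LStr L} (f : Iso M N) : M.card = N.card := by
  rw [← Cardinal.lift_inj.{u, u + 1}, card, card, ← ZFSet.cardinalMk_coe_sort,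
    ← ZFSet.cardinalMk_coe_sort]
  exact Cardinal.mk_congr f.toEquiv

/-- `M'` has as its universe the image `f[|M|]` of the universe of `M`, where `|M| ⊆ |N|` and
`f : N ≅ N'`. A submodel `M'` of `N'` with this property is the structure `f(M)`. -/
def IsImage {N N' : LStr L} (f : Iso N N') (M M' : LStr L) : Prop :=
  ∀ y, y ∈ M'.carrier ↔ ∃ x : N.carrier, (x : ZFSet.{u}) ∈ M.carrier ∧ (f.toEquiv x : ZFSet.{u}) = y

theorem IsImage.card_eq {N N' M M' : LStr L} {f : Iso N N'} (hM : M.IsSub N)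
    (h : IsImage f M M') : M'.card = M.card := by
  rw [← Cardinal.lift_inj.{u, u + 1}, card, card, ← ZFSet.cardinalMk_coe_sort,
    ← ZFSet.cardinalMk_coe_sort]
  symm
  refine Cardinal.mk_congr (Equiv.ofBijective
    (fun x : M.carrier => (⟨f.toEquiv ⟨x, hM.subset _ x.2⟩, (h _).2 ⟨_, x.2, rfl⟩⟩ : M'.carrier))
    ⟨fun x y hxy => ?_, fun y => ?_⟩)
  · have h0 := congrArg (fun z : M'.carrier => (z : ZFSet.{u})) hxy
    have h1 := f.toEquiv.injective (Subtype.ext h0)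
    exact Subtype.ext (Subtype.mk.inj h1)
  · obtain ⟨x, hx, hy⟩ := (h y).1 y.2
    exact ⟨⟨x, hx⟩, Subtype.ext hy⟩

/-- `U` is the union of the family `M` of structures: its universe is the union of the universes
and every `M i` is a submodel of `U`. (For a `μ`-directed system the union exists and is unique,
because every tuple of length `< μ` of elements of the union lies in some `M i`.) -/
structure IsUnion {I : Type u} (M : I → LStr L) (U : LStr L) : Prop where
  mem_iff : ∀ x, x ∈ U.carrier ↔ ∃ i, x ∈ (M i).carrier
  isSub : ∀ i, (M i).IsSub U

end LStr

/-- A `μ`-abstract class in the language `L`: a class of `L`-structures with a reflexive and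
transitive relation on it, which refines the submodel relation and respects isomorphisms. -/
structure AbstractClass {μ : Cardinal.{u}} (L : MuLanguage μ) where
  Mem : LStr L → Prop
  Le : LStr L → LStr L → Prop
  mem_of_le : ∀ {M N}, Le M N → Mem M ∧ Mem N
  le_refl : ∀ {M}, Mem M → Le M M
  le_trans : ∀ {M N P}, Le M N → Le N P → Le M P
  isSub : ∀ {M N}, Le M N → M.IsSub N
  mem_of_iso : ∀ {N N' : LStr L}, LStr.Iso N N' → Mem N → Mem N'
  image_le : ∀ {N N' M : LStr L} (f : LStr.Iso N N'), Le M N →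
    ∃ M', LStr.IsImage f M M' ∧ Le M' N'

/-- Every subset of the partially ordered set `I` of cardinality less than `μ` has an upper
bound. -/
def IsMuDirected (μ : Cardinal.{u}) (I : Type u) [PartialOrder I] : Prop :=
  ∀ J : Set I, #J < μ → ∃ r : I, ∀ s ∈ J, s ≤ r

namespace AbstractClass

variable {μ : Cardinal.{u}} {L : MuLanguage μ}

/-- `κ` witnesses the Löwenheim-Skolem-Tarski axiom for `K`
(`a ^< b` is the supremum of `a ^ c` over the cardinals `c < b`). -/
def IsLST (K : AbstractClass L) (κ : Cardinal.{u}) : Prop :=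
  κ = κ ^< μ ∧ L.size + μ ≤ κ ∧
    ∀ M, K.Mem M → ∀ A : ZFSet.{u}, A ⊆ M.carrier →
      ∃ N, K.Le N M ∧ A ⊆ N.carrier ∧ N.card ≤ A.card ^< μ + κ

/-- `LS(K)`, the least cardinal which witnesses the Löwenheim-Skolem-Tarski axiom. -/
noncomputable def LS (K : AbstractClass L) : Cardinal.{u} :=
  sInf {κ | K.IsLST κ}

/-- `K` is a `μ`-abstract elementary class. -/
structure IsMuAEC (K : AbstractClass L) : Prop where
  regular : μ.IsRegular
  coherence : ∀ {M₀ M₁ M₂}, K.Le M₀ M₂ → K.Le M₁ M₂ → M₀.IsSub M₁ → K.Le M₀ M₁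
  /-- The two Tarski-Vaught axioms; `U` is the union of the `μ`-directed system. -/
  tarski_vaught : ∀ (I : Type u) [PartialOrder I], IsMuDirected μ I →
    ∀ M : I → LStr L, (∀ i, K.Mem (M i)) → (∀ i j, i < j → K.Le (M i) (M j)) →
      ∃ U, LStr.IsUnion M U ∧ K.Mem U ∧ (∀ j, K.Le (M j) U) ∧
        ∀ N, K.Mem N → (∀ i, K.Le (M i) N) → K.Le U N
  lst : ∃ κ, K.IsLST κ

/-- The abstract class `K_κ` of the structures in `K` of cardinality `κ`. -/
def ofCard (K : AbstractClass L) (κ : Cardinal.{u}) : AbstractClass L where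
  Mem M := K.Mem M ∧ M.card = κ
  Le M N := K.Le M N ∧ M.card = κ ∧ N.card = κ
  mem_of_le h := ⟨⟨(K.mem_of_le h.1).1, h.2.1⟩, ⟨(K.mem_of_le h.1).2, h.2.2⟩⟩
  le_refl h := ⟨K.le_refl h.1, h.2, h.2⟩
  le_trans h h' := ⟨K.le_trans h.1 h'.1, h.2.1, h'.2.2⟩
  isSub h := K.isSub h.1
  mem_of_iso f h := ⟨K.mem_of_iso f h.1, f.card_eq ▸ h.2⟩
  image_le f h := by
    obtain ⟨M', hM', hle⟩ := K.image_le f h.1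
    exact ⟨M', hM', hle, (hM'.card_eq (K.isSub h.1)).trans h.2.1, f.card_eq ▸ h.2.2⟩

/-- Isomorphism, as an equivalence relation on the structures in `K` of cardinality `κ`. -/
def isoSetoid (K : AbstractClass L) (κ : Cardinal.{u}) :
    Setoid {M : LStr L // (K.ofCard κ).Mem M} where
  r M N := Nonempty (LStr.Iso M.1 N.1)
  iseqv :=
    { refl := fun M => ⟨LStr.Iso.refl M.1⟩
      symm := fun ⟨f⟩ => ⟨f.symm⟩
      trans := fun ⟨f⟩ ⟨g⟩ => ⟨f.trans g⟩ }

/-- `I(κ, K)`, the number of structures in `K` of cardinality `κ` up to isomorphism. -/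
noncomputable def numModels (K : AbstractClass L) (κ : Cardinal.{u}) : Cardinal.{u + 1} :=
  #(Quotient (K.isoSetoid κ))

/-- The extension property for `δ`-chains. -/
def ChainExtension (K : AbstractClass L) (δ : Ordinal.{u}) : Prop :=
  ∀ M : Set.Iio δ → LStr L, (∀ i, K.Mem (M i)) → (∀ i j, i < j → K.Le (M i) (M j)) →
    ∃ N, K.Mem N ∧ ∀ i, K.Le (M i) N

/-- `f` is a `K`-embedding of `M` into `N`: an isomorphism from `M` onto some `N₀ ≤ N`. -/
def IsEmb (K : AbstractClass L) {M N : LStr L} (f : M.carrier → N.carrier) : Prop :=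
  ∃ (N₀ : LStr L) (g : LStr.Iso M N₀), K.Le N₀ N ∧
    ∀ x, (f x : ZFSet.{u}) = g.toEquiv x

/-- `K` has amalgamation in `κ`: any two extensions `M₁`, `M₂` in `K_κ` of `M₀` in `K_κ` embed
into some `N` in `K_κ` by embeddings that agree on `M₀`. -/
def HasAmalgamation (K : AbstractClass L) (κ : Cardinal.{u}) : Prop :=
  ∀ (M₀ M₁ M₂ : LStr L) (h₁ : (K.ofCard κ).Le M₀ M₁) (h₂ : (K.ofCard κ).Le M₀ M₂),
    ∃ (N : LStr L) (f₁ : M₁.carrier → N.carrier) (f₂ : M₂.carrier → N.carrier),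
      (K.ofCard κ).Mem N ∧ K.IsEmb f₁ ∧ K.IsEmb f₂ ∧
      ∀ x : M₀.carrier,
        f₁ ⟨x, ((K.ofCard κ).isSub h₁).subset _ x.2⟩ = f₂ ⟨x, ((K.ofCard κ).isSub h₂).subset _ x.2⟩

end AbstractClass

/-! Suppose amalgamation fails in `κ`, witnessed by `M₁`, `M₂` over `M₀`. By categoricity this
failure can be copied over every model of size `κ`. For each `η : κ⁺ → 2` an increasing chain `M η`
of length `κ⁺` is built, with universes inside one fixed set of size `κ⁺`. The union `V η` has size
`κ⁺`, and the aim is that `V η` and `V ν` are non-isomorphic for all `η ≠ ν`. This gives `2 ^ κ⁺`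
models outright.

The tool is diamond on the points of `κ⁺` of cofinality `μ` (`exists_diamond`), which follows from
`κ ^ μ = κ` and `2 ^ κ = κ⁺`. It guesses initial segments of two branches, their two chains and a
map between the unions. At a stage `δ` where the guess is about `η`, `ν` and the map can be extended
without amalgam, `exists_runs` lets `M η δ` and `M ν δ` be extensions that do not amalgamate over
the guessed map.

Given `F : V η ≅ V ν`, some such `δ` guesses `η`, `ν`, both chains and `F` correctly and is closed
enough that `F` maps the union below `δ` of one chain onto that of the other. These unions are
models, because `δ` is `μ`-directed. A copy of the splitting over them shows that a non-amalgamating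
pair exists, so one was chosen. But `F` embeds `M η δ` beside `M ν δ` in `V ν`, and the
Löwenheim–Skolem–Tarski axiom cuts out an amalgam of size `κ`: a contradiction. -/

/-! ### Well-founded recursion with choices -/

/-- Dependent choice along a well-order: each value is chosen by `epsilon` from the earlier ones,
padded by a default. Locality of `P` makes the padding harmless, and existence is needed only when
the earlier choices are good. -/
theorem exists_forall_of_wellFounded {D : Type*} {X : Type*} [LT D] [WellFoundedLT D] [Nonempty X]
    (P : D → (D → X) → X → Prop)
    (hloc : ∀ d s t x, (∀ e < d, s e = t e) → P d s x → P d t x)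
    (hex : ∀ d s, (∀ e < d, P e s (s e)) → ∃ x, P d s x) : ∃ s, ∀ d, P d s (s d) := by
  classical
  obtain ⟨x₀⟩ := ‹Nonempty X›
  let ext : ∀ d : D, (∀ e : D, e < d → X) → D → X :=
    fun d prev e => if h : e < d then prev e h else x₀
  let s : D → X := (wellFounded_lt (α := D)).fix
    (fun d prev => Classical.epsilon (h := ⟨x₀⟩) (P d (ext d prev)))
  have hs : ∀ d, s d = Classical.epsilon (h := ⟨x₀⟩) (P d (ext d fun e _ => s e)) := fun d =>
    WellFounded.fix_eq _ _ d
  have hagree : ∀ d, ∀ e < d, ext d (fun e _ => s e) e = s e := fun d e he => by simp [ext, he]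
  refine ⟨s, fun d => ?_⟩
  induction d using (wellFounded_lt (α := D)).induction with
  | _ d ih =>
    obtain ⟨x, hx⟩ := hex d s ih
    refine hloc d _ s _ (hagree d) ?_
    rw [hs d]
    exact Classical.epsilon_spec (p := P d (ext d fun e _ => s e))
      ⟨x, hloc d s _ x (fun e he => (hagree d e he).symm) hx⟩

theorem Cardinal.IsRegular.exists_forall_lt {c : Cardinal.{u}} (hc : c.IsRegular)
    (s : Set c.ord.ToType) (hs : #s < c) : ∃ b, ∀ x ∈ s, x < b := by
  by_contra! h
  have h1 : Order.cof c.ord.ToType ≤ #s := Order.cof_le h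
  rw [Ordinal.cof_toType, hc.cof_ord] at h1
  exact absurd hs h1.not_gt

/-! ### Diamond on the points of cofinality `μ` -/

section Diamond

variable {κ μ : Cardinal.{u}} {W : Type u} [LinearOrder W] [WellFoundedLT W]

/-- Iterate `h` along a strictly increasing sequence of length `μ` and let `δ` be its supremum.
Regularity of `μ` makes the segment below `δ` `μ`-directed. -/
theorem exists_closed_point (hμ : μ.IsRegular) (hμκ : μ ≤ κ)
    (hb : ∀ s : Set W, #s ≤ κ → ∃ b, ∀ x ∈ s, x < b) (hI : ∀ a : W, #(Set.Iio a) ≤ κ)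
    (h : W → W) :
    ∃ (δ : W) (a : μ.ord.ToType → W), (∀ d, a d < δ) ∧ (∀ x < δ, ∃ d, x < a d) ∧
      (∀ x < δ, h x < δ) ∧ IsMuDirected μ (Set.Iio δ) := by
  have hκ : ℵ₀ ≤ κ := hμ.aleph0_le.trans hμκ
  have hD : #μ.ord.ToType = μ := by simp
  have hne : Nonempty W := by
    obtain ⟨b, -⟩ := hb ∅ (by simp)
    exact ⟨b⟩
  obtain ⟨a, ha⟩ := exists_forall_of_wellFounded
    (fun (d : μ.ord.ToType) (s : μ.ord.ToType → W) x => ∀ e < d, s e < x ∧ ∀ y < s e, h y < x)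
    (fun d s t x hst H e he => by rw [← hst e he]; exact H e he)
    (fun d s _ => by
      obtain ⟨b, hb'⟩ := hb (⋃ e : μ.ord.ToType, insert (s e) (h '' Set.Iio (s e))) (by
        refine (mk_iUnion_le _).trans ?_
        refine (mul_le_mul' (hD.le.trans hμκ) (ciSup_le' fun e => ?_)).trans (mul_eq_self hκ).le
        exact mk_insert_le.trans
          (add_le_of_le hκ (mk_image_le.trans (hI _)) (one_le_aleph0.trans hκ)))
      refine ⟨b, fun e _ => ⟨hb' _ ?_, fun y hy => hb' _ ?_⟩⟩
      · exact Set.mem_iUnion.2 ⟨e, Set.mem_insert _ _⟩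
      · exact Set.mem_iUnion.2 ⟨e, Set.mem_insert_of_mem _ ⟨y, hy, rfl⟩⟩)
  have hD' : ∀ s : Set μ.ord.ToType, #s < μ → ∃ b, ∀ x ∈ s, x < b := hμ.exists_forall_lt
  have hsucc : ∀ d : μ.ord.ToType, ∃ e, d < e := fun d => by
    obtain ⟨b, hb⟩ := hD' {d} (by simpa using one_lt_aleph0.trans_le hμ.aleph0_le)
    exact ⟨b, hb d rfl⟩
  have hub : {b : W | ∀ d, a d < b}.Nonempty := by
    obtain ⟨b, hb'⟩ := hb (Set.range a) (mk_range_le.trans (hD.le.trans hμκ))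
    exact ⟨b, fun d => hb' _ ⟨d, rfl⟩⟩
  obtain ⟨δ, hδ, hmin⟩ := (wellFounded_lt (α := W)).has_min _ hub
  have hcof : ∀ x < δ, ∃ d, x < a d := fun x hx => by
    by_contra! H
    refine hmin x (fun d => ?_) hx
    obtain ⟨e, he⟩ := hsucc d
    exact ((ha e d he).1).trans_le (H e)
  refine ⟨δ, a, hδ, hcof, fun x hx => ?_, fun J hJ => ?_⟩
  · obtain ⟨d, hd⟩ := hcof x hx
    obtain ⟨e, he⟩ := hsucc d
    exact ((ha e d he).2 x hd).trans (hδ e)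
  · choose f hf using fun x : Set.Iio δ => hcof x x.2
    obtain ⟨b, hb'⟩ := hD' (f '' J) (mk_image_le.trans_lt hJ)
    refine ⟨⟨a b, hδ b⟩, fun x hx => ?_⟩
    exact ((hf x).trans (ha b _ (hb' _ ⟨x, hx, rfl⟩)).1).le

/-- Gregory's argument, with `κ` candidates at each `δ`. Code every bounded function by a point of
`W`. If `δ` is closed under coding the restrictions of `X`, then `X` below `δ` is recovered from `μ`
many codes below `δ`, and there are only `κ ^ μ = κ` such sequences. -/
theorem exists_family_guess (hμ : μ.IsRegular) (hμκ : μ ≤ κ) (hpow : κ ^ μ = κ)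
    (hch : (2 : Cardinal.{u}) ^ κ = Order.succ κ)
    (hb : ∀ s : Set W, #s ≤ κ → ∃ b, ∀ x ∈ s, x < b) (hI : ∀ a : W, #(Set.Iio a) ≤ κ)
    (hW : #W = Order.succ κ)
    {T : Type u} [Nonempty T] (hT : #T ≤ Order.succ κ) :
    ∃ G : W → κ.ord.ToType → W → T, ∀ (X : W → T) (h : W → W), ∃ δ, IsMuDirected μ (Set.Iio δ) ∧
      (∀ x < δ, h x < δ) ∧ ∃ i, ∀ x < δ, G δ i x = X x := by
  have hκ : ℵ₀ ≤ κ := hμ.aleph0_le.trans hμκ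
  have hpow' : (Order.succ κ) ^ κ = Order.succ κ := by
    rw [← hch, ← power_mul, mul_eq_self hκ]
  obtain ⟨c⟩ : Nonempty ((Σ b : W, (Set.Iio b → T)) ↪ W) := by
    rw [← Cardinal.le_def, mk_sigma]
    refine (sum_le_mk_mul_iSup _).trans ?_
    rw [hW]
    refine (mul_le_mul' le_rfl (ciSup_le' fun b => ?_)).trans
      (mul_eq_self (hκ.trans (Order.le_succ κ))).le
    rw [← power_def]
    refine (power_le_power_right hT).trans ((power_le_power_left ?_ (hI b)).trans hpow'.le)
    exact (succ_pos κ).ne'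
  have he : ∀ δ : W, Nonempty ((μ.ord.ToType → Set.Iio δ) ↪ κ.ord.ToType) := fun δ => by
    rw [← Cardinal.le_def, ← power_def, mk_ord_toType]
    exact (power_le_power_right (hI δ)).trans (by simp [hpow])
  have e := fun δ => Classical.choice (he δ)
  -- `t` is the value at `x` of one of the functions coded by the terms of the `i`-th sequence below
  -- `δ`.
  let R : W → κ.ord.ToType → W → T → Prop := fun δ i x t => ∃ s : μ.ord.ToType → Set.Iio δ, e δ s = i ∧
    ∃ d b, ∃ g : Set.Iio b → T, ∃ hx : x < b, c ⟨b, g⟩ = s d ∧ g ⟨x, hx⟩ = t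
  refine ⟨fun δ i x => Classical.epsilon (R δ i x), fun X h => ?_⟩
  let k : W → W := fun x => c ⟨x, fun y => X y⟩
  obtain ⟨δ, a, haδ, hcof, hcl, hdir⟩ :=
    exists_closed_point hμ hμκ hb hI (fun x => max (h x) (k x))
  refine ⟨δ, hdir, fun x hx => (le_max_left _ _).trans_lt (hcl x hx),
    e δ (fun d => ⟨k (a d), (le_max_right _ _).trans_lt (hcl _ (haδ d))⟩), fun x hx => ?_⟩
  obtain ⟨d, hd⟩ := hcof x hx
  -- The choice may use another term `d'` of the sequence, but injectivity of `e δ` and `c` forces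
  -- `g` to be a restriction of `X`, so the value is `X x` all the same.
  obtain ⟨s, hs, d', b, g, hxb, hc, hg⟩ := Classical.epsilon_spec (p := R δ (e δ (fun d =>
    ⟨k (a d), (le_max_right _ _).trans_lt (hcl _ (haδ d))⟩)) x)
    ⟨X x, _, rfl, d, a d, _, hd, rfl, rfl⟩
  refine hg.symm.trans ?_
  have := (e δ).injective hs
  subst this
  have := c.injective hc
  cases this
  rfl

/-- Gregory's theorem: if `κ ^ μ = κ` and `2 ^ κ = κ⁺`, then the diamond principle holds on the
set of points of `κ⁺` of cofinality `μ`. -/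
theorem exists_diamond (hμ : μ.IsRegular) (hμκ : μ ≤ κ) (hpow : κ ^ μ = κ)
    (hch : (2 : Cardinal.{u}) ^ κ = Order.succ κ)
    (hb : ∀ s : Set W, #s ≤ κ → ∃ b, ∀ x ∈ s, x < b) (hI : ∀ a : W, #(Set.Iio a) ≤ κ)
    (hW : #W = Order.succ κ)
    {T : Type u} [Nonempty T] (hT : #T ≤ Order.succ κ) :
    ∃ G : W → W → T, ∀ (X : W → T) (h : W → W), ∃ δ, IsMuDirected μ (Set.Iio δ) ∧
      (∀ x < δ, h x < δ) ∧ ∀ x < δ, G δ x = X x := by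
  have hκ : ℵ₀ ≤ κ := hμ.aleph0_le.trans hμκ
  have hT' : #(κ.ord.ToType → T) ≤ Order.succ κ := by
    rw [← power_def, mk_ord_toType]
    refine (power_le_power_right hT).trans ?_
    rw [← hch, ← power_mul, mul_eq_self hκ]
  obtain ⟨G, hG⟩ := exists_family_guess hμ hμκ hpow hch hb hI hW hT'
  -- From `κ` candidates to one: if every column `i` fails for some `X i` and `h i`, guess all the
  -- `X i` simultaneously. The index `i` of the correct candidate contradicts the failure of column
  -- `i`; `k` dominates all the `h i`, so closure under `k` suffices.
  by_contra! H
  choose X h H using fun i : κ.ord.ToType => H fun δ x => G δ i x i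
  choose k hk using fun x => hb (Set.range fun i => h i x) (mk_range_le.trans (mk_ord_toType κ).le)
  obtain ⟨δ, hdir, hcl, i, hi⟩ := hG (fun x i => X i x) k
  obtain ⟨x, hx, hne⟩ := H i δ hdir (fun x hx => (hk x _ ⟨i, rfl⟩).trans (hcl x hx))
  exact hne (congrFun (hi x hx) i)

end Diamond

/-! ### Substructures, restriction and transport of structure -/

namespace LStr

variable {μ : Cardinal.{u}} {L : MuLanguage μ}

theorem IsSub.refl (M : LStr L) : M.IsSub M := ⟨fun _ h => h, fun _ _ => rfl, fun _ _ => Iff.rfl⟩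

theorem IsSub.eq_of_mem_iff {A B N : LStr L} (hA : A.IsSub N) (hB : B.IsSub N)
    (h : ∀ x, x ∈ A.carrier ↔ x ∈ B.carrier) : A = B := by
  obtain ⟨C, f, r⟩ := A
  obtain ⟨C', f', r'⟩ := B
  obtain rfl : C = C' := ZFSet.ext h
  congr
  · funext F a
    exact Subtype.ext ((hA.func_eq F a).trans (hB.func_eq F a).symm)
  · funext R a
    exact propext ((hA.rel_iff R a).trans (hB.rel_iff R a).symm)

theorem IsSub.eq_of_subset {M N : LStr L} (h : M.IsSub N) (h' : ∀ x ∈ N.carrier, x ∈ M.carrier) :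
    M = N :=
  h.eq_of_mem_iff (IsSub.refl N) fun x => ⟨h.subset x, h' x⟩

theorem IsSub.of_iso {U V N N' : LStr L} (h : U.IsSub N) (g : Iso N N') (f : Iso U V)
    (hfg : ∀ x : U.carrier, (f.toEquiv x : ZFSet.{u}) = g.toEquiv ⟨x, h.subset _ x.2⟩) :
    V.IsSub N' := by
  have key : ∀ y : V.carrier, (y : ZFSet.{u}) =
      g.toEquiv ⟨f.toEquiv.symm y, h.subset _ (f.toEquiv.symm y).2⟩ := fun y => by
    rw [← hfg, Equiv.apply_symm_apply]
  have hsub : ∀ y ∈ V.carrier, y ∈ N'.carrier := fun y hy => by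
    have := key ⟨y, hy⟩
    simp only at this
    rw [this]
    exact Subtype.prop _
  have hfun : ∀ {ι : Type (u + 1)} (a : ι → V.carrier),
      (fun i => g.toEquiv ⟨f.toEquiv.symm (a i), h.subset _ (f.toEquiv.symm (a i)).2⟩) =
        fun i => (⟨a i, hsub _ (a i).2⟩ : N'.carrier) := fun a =>
    funext fun i => Subtype.ext (key (a i)).symm
  refine ⟨hsub, fun F a => ?_, fun R a => ?_⟩
  · have h1 := f.map_func F (fun i => f.toEquiv.symm (a i))
    simp only [Equiv.apply_symm_apply] at h1
    rw [← h1, hfg, ← hfun, ← g.map_func]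
    congr 2
    exact Subtype.ext (h.func_eq F _)
  · have h1 := f.map_rel R (fun i => f.toEquiv.symm (a i))
    simp only [Equiv.apply_symm_apply] at h1
    rw [← h1, ← hfun, ← g.map_rel]
    exact h.rel_iff R _

theorem IsSub.of_isSub {M P V : LStr L} (hM : M.IsSub V) (hP : P.IsSub V)
    (h : ∀ x ∈ M.carrier, x ∈ P.carrier) : M.IsSub P := by
  refine ⟨h, fun F a => ?_, fun R a => ?_⟩
  · rw [hM.func_eq, hP.func_eq]
  · rw [hM.rel_iff, hP.rel_iff]

theorem Iso.eq_of_coe_eq {M N : LStr L} (f : Iso M N)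
    (h : ∀ x, (f.toEquiv x : ZFSet.{u}) = x) : M = N := by
  have hsub : M.IsSub N := (IsSub.refl N).of_iso (Iso.refl N) f.symm fun x => by
    have := h (f.toEquiv.symm x)
    rw [Equiv.apply_symm_apply] at this
    exact this.symm
  refine hsub.eq_of_subset fun x hx => ?_
  have := h (f.toEquiv.symm ⟨x, hx⟩)
  rw [Equiv.apply_symm_apply] at this
  exact (show x = _ from this) ▸ Subtype.prop _

theorem Iso.exists_restrict {A B U V : LStr L} (F : Iso A B) (hU : U.IsSub A) (hV : V.IsSub B)
    (h : IsImage F U V) :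
    ∃ g : Iso U V, ∀ x, (g.toEquiv x : ZFSet.{u}) = F.toEquiv ⟨x, hU.subset _ x.2⟩ := by
  let e : U.carrier ≃ V.carrier := Equiv.ofBijective
    (fun x => ⟨F.toEquiv ⟨x, hU.subset _ x.2⟩, (h _).2 ⟨_, x.2, rfl⟩⟩)
    ⟨fun x y hxy => by
      have h0 := congrArg (fun z : V.carrier => (z : ZFSet.{u})) hxy
      have h1 := F.toEquiv.injective (Subtype.ext h0)
      exact Subtype.ext (Subtype.mk.inj h1),
     fun y => by
      obtain ⟨x, hx, hy⟩ := (h y).1 y.2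
      exact ⟨⟨x, hx⟩, Subtype.ext hy⟩⟩
  have he : ∀ x, (e x : ZFSet.{u}) = F.toEquiv ⟨x, hU.subset _ x.2⟩ := fun x => rfl
  have hfun : ∀ {ι : Type (u + 1)} (a : ι → U.carrier),
      (fun i => (⟨e (a i), hV.subset _ (e (a i)).2⟩ : B.carrier)) =
        fun i => F.toEquiv ⟨a i, hU.subset _ (a i).2⟩ := fun a =>
    funext fun i => Subtype.ext (he _)
  refine ⟨⟨e, fun f a => Subtype.ext ?_, fun R a => ?_⟩, he⟩
  · rw [he, hV.func_eq, hfun, ← F.map_func]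
    congr 2
    exact Subtype.ext (hU.func_eq f a)
  · rw [hV.rel_iff, hfun, ← F.map_rel]
    exact hU.rel_iff R a

theorem mk_carrier (M : LStr L) : #M.carrier = Cardinal.lift.{u + 1} M.card :=
  ZFSet.cardinalMk_coe_sort

theorem IsSub.card_le {M N : LStr L} (h : M.IsSub N) : M.card ≤ N.card :=
  ZFSet.card_mono fun x hx => h.subset x hx

/-- The structure transported along a bijection of its universe with the set `C`. -/
def transport (N : LStr L) {C : ZFSet.{u}} (e : N.carrier ≃ C) : LStr L where
  carrier := C
  func F a := e (N.func F fun i => e.symm (a i))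
  rel R a := N.rel R fun i => e.symm (a i)

/-- The isomorphism of a structure with its transport. -/
def isoTransport (N : LStr L) {C : ZFSet.{u}} (e : N.carrier ≃ C) : Iso N (N.transport e) where
  toEquiv := e
  map_func F a := by
    change e (N.func F a) = e (N.func F fun i => e.symm (e (a i)))
    simp only [Equiv.symm_apply_apply]
  map_rel R a := by
    change N.rel R a ↔ N.rel R fun i => e.symm (e (a i))
    simp only [Equiv.symm_apply_apply]

end LStr

/-- The range of `j` has size at most `κ`, so `κ⁺` points remain free for the rest of `X`. -/
theorem exists_injective_extension {κ : Cardinal.{u}} (hκ : ℵ₀ ≤ κ) {W : Type u}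
    (hW : #W = Order.succ κ) {X : Type (u + 1)} (hX : #X ≤ Cardinal.lift.{u + 1} κ) (A : Set X)
    (j : A → W) (hj : Function.Injective j) :
    ∃ g : X → W, Function.Injective g ∧ ∀ x : A, g x = j x := by
  classical
  have hrange : #(Set.range j) ≤ κ := by
    rw [← Cardinal.lift_le.{u + 1}]
    exact mk_range_le_lift.trans (by
      rw [Cardinal.lift_id'.{u, u + 1}]
      exact (mk_set_le A).trans hX)
  have : Infinite W := by
    rw [Cardinal.infinite_iff, hW]
    exact hκ.trans (Order.le_succ κ)
  have hcompl : #((Set.range j)ᶜ : Set W) = Order.succ κ := by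
    rw [mk_compl_of_infinite _ (by rw [hW]; exact Order.lt_succ_of_le hrange), hW]
  obtain ⟨k⟩ : Nonempty (X ↪ ((Set.range j)ᶜ : Set W)) := by
    rw [← Cardinal.lift_mk_le'.{u + 1, u}, hcompl, Cardinal.lift_id'.{u, u + 1}]
    exact hX.trans (Cardinal.lift_le.2 (Order.le_succ κ))
  refine ⟨fun x => if h : x ∈ A then j ⟨x, h⟩ else k x, fun x y hxy => ?_, fun x => by simp⟩
  by_cases hx : x ∈ A <;> by_cases hy : y ∈ A <;> simp only [hx, hy, dif_pos, dif_neg,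
    not_false_eq_true] at hxy
  · exact Subtype.mk.inj (hj hxy)
  · exact absurd ⟨_, hxy⟩ (k y).2
  · exact absurd ⟨_, hxy.symm⟩ (k x).2
  · exact k.injective (Subtype.ext hxy)

namespace LStr

variable {μ : Cardinal.{u}} {L : MuLanguage μ}

theorem exists_iso_range {κ : Cardinal.{u}} (hκ : ℵ₀ ≤ κ) {W : Type u} (hW : #W = Order.succ κ)
    {o : W → ZFSet.{u}} (ho : Function.Injective o) {N : LStr L} (hN : N.card ≤ κ)
    (A : Set N.carrier) (j : A → ZFSet.{u}) (hj : Function.Injective j) (hjo : ∀ x, ∃ w, o w = j x) :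
    ∃ (N' : LStr L) (g : Iso N N'), (∀ x ∈ N'.carrier, ∃ w, o w = x) ∧
      ∀ x : A, (g.toEquiv x : ZFSet.{u}) = j x := by
  choose i hi using hjo
  obtain ⟨g, hg, hgi⟩ := exists_injective_extension hκ hW
    (N.mk_carrier.trans_le (Cardinal.lift_le.2 hN)) A i fun x y hxy => hj (by
      rw [← hi, hxy, hi])
  have hsmall : Small.{u} N.carrier := inferInstance
  let C : ZFSet.{u} := ZFSet.range fun x => o (g x)
  let e : N.carrier ≃ C := Equiv.ofBijective
    (fun x => ⟨o (g x), ZFSet.mem_range.2 ⟨x, rfl⟩⟩)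
    ⟨fun x y hxy => hg (ho (Subtype.mk.inj hxy)), fun y => by
      obtain ⟨x, hx⟩ := ZFSet.mem_range.1 y.2
      exact ⟨x, Subtype.ext hx⟩⟩
  refine ⟨N.transport e, N.isoTransport e, fun x hx => ?_, fun x => ?_⟩
  · obtain ⟨y, hy⟩ := ZFSet.mem_range.1 hx
    exact ⟨_, hy⟩
  · change o (g x) = _
    rw [hgi, hi]

end LStr

/-! ### Invariance under isomorphism, and coding by categoricity -/

namespace AbstractClass

variable {μ : Cardinal.{u}} {L : MuLanguage μ} {K : AbstractClass L} {κ : Cardinal.{u}}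

theorem le_of_iso {U V N N' : LStr L} (h : K.Le U N) (g : LStr.Iso N N') (f : LStr.Iso U V)
    (hfg : ∀ x : U.carrier, (f.toEquiv x : ZFSet.{u}) =
      g.toEquiv ⟨x, (K.isSub h).subset _ x.2⟩) : K.Le V N' := by
  obtain ⟨M', hM', hle⟩ := K.image_le g h
  have : V = M' := ((K.isSub h).of_iso g f hfg).eq_of_mem_iff (K.isSub hle) fun y => by
    rw [hM']
    constructor
    · intro hy
      refine ⟨⟨f.toEquiv.symm ⟨y, hy⟩, (K.isSub h).subset _ (Subtype.prop _)⟩, (f.toEquiv.symm ⟨y, hy⟩).2, ?_⟩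
      rw [← hfg, Equiv.apply_symm_apply]
    · rintro ⟨x, hx, rfl⟩
      rw [← hfg ⟨x, hx⟩]
      exact Subtype.prop _
  rwa [this]

theorem isEmb_of_le {M N : LStr L} (h : K.Le M N) :
    K.IsEmb fun x : M.carrier => (⟨x, (K.isSub h).subset _ x.2⟩ : N.carrier) :=
  ⟨M, LStr.Iso.refl M, h, fun _ => rfl⟩

theorem IsEmb.comp_iso {M N P : LStr L} {f : N.carrier → P.carrier} (hf : K.IsEmb f)
    (g : LStr.Iso M N) : K.IsEmb (fun x => f (g.toEquiv x)) := by
  obtain ⟨N₀, k, hle, hk⟩ := hf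
  exact ⟨N₀, g.trans k, hle, fun x => hk _⟩

theorem nonempty_iso_of_numModels (hcat : K.numModels κ = 1) {M N : LStr L}
    (hM : (K.ofCard κ).Mem M) (hN : (K.ofCard κ).Mem N) : Nonempty (LStr.Iso M N) := by
  have := Cardinal.le_one_iff_subsingleton.1 hcat.le
  exact Quotient.exact (s := K.isoSetoid κ) (Subsingleton.elim (Quotient.mk _ ⟨M, hM⟩) (Quotient.mk _ ⟨N, hN⟩))

/-- In a categorical cardinal `κ`, the models with universe in `range o` can be coded by functions
from `κ` into the index set. -/
theorem exists_decoding (hcat : K.numModels κ = 1) {W : Type u} (o : W → ZFSet.{u}) {M : LStr L}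
    (hM : (K.ofCard κ).Mem M) : ∃ dec : (κ.ord.ToType → W) → LStr L,
      ∀ N, (K.ofCard κ).Mem N → (∀ x ∈ N.carrier, ∃ w, o w = x) → ∃ c, dec c = N := by
  obtain ⟨a⟩ : Nonempty (κ.ord.ToType ≃ M.carrier) := by
    rw [← Cardinal.lift_mk_eq'.{u, u + 1}, LStr.mk_carrier, mk_ord_toType, hM.2,
      Cardinal.lift_id'.{u, u + 1}]
  -- With `a` an enumeration of `M`, a code lists the images of the `a i` under some isomorphism
  -- from `M`. It determines the target structure, universe included.
  let R : (κ.ord.ToType → W) → LStr L → Prop := fun c N =>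
    ∃ k : LStr.Iso M N, ∀ i, (k.toEquiv (a i) : ZFSet.{u}) = o (c i)
  refine ⟨fun c => @Classical.epsilon _ ⟨M⟩ (R c), fun N hN hNo => ?_⟩
  obtain ⟨k⟩ := nonempty_iso_of_numModels hcat hM hN
  choose c hc using fun i => hNo (k.toEquiv (a i)) (Subtype.prop _)
  obtain ⟨k', hk'⟩ := @Classical.epsilon_spec _ (R c) ⟨N, k, fun i => (hc i).symm⟩
  refine ⟨c, (k'.symm.trans k).eq_of_coe_eq fun x => ?_⟩
  obtain ⟨y, rfl⟩ := k'.toEquiv.surjective x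
  obtain ⟨i, rfl⟩ := a.surjective y
  refine Eq.trans ?_ ((hc i).symm.trans (hk' i).symm)
  exact congrArg (fun z => (k.toEquiv z : ZFSet.{u})) (Equiv.symm_apply_apply _ _)

end AbstractClass

/-! ### Splittings and their copies -/

namespace AbstractClass

variable {μ : Cardinal.{u}} {L : MuLanguage μ} {K : AbstractClass L} {κ : Cardinal.{u}}

/-- `N` and `N'` have a common extension in `K_κ` into which they embed so that elements related
by `r` are identified. -/
def AmalgamatesOver (K : AbstractClass L) (κ : Cardinal.{u}) (r : ZFSet.{u} → ZFSet.{u} → Prop)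
    (N N' : LStr L) : Prop :=
  ∃ (P : LStr L) (g : N.carrier → P.carrier) (g' : N'.carrier → P.carrier),
    (K.ofCard κ).Mem P ∧ K.IsEmb g ∧ K.IsEmb g' ∧
      ∀ (x : N.carrier) (y : N'.carrier), r x y → g x = g' y

/-- `M₁` and `M₂` are extensions of `M₀` in `K_κ` which cannot be amalgamated. -/
structure IsSplitting (K : AbstractClass L) (κ : Cardinal.{u}) (M₀ M₁ M₂ : LStr L) : Prop where
  left : (K.ofCard κ).Le M₀ M₁
  right : (K.ofCard κ).Le M₀ M₂
  not_amalgamates : ¬ K.AmalgamatesOver κ (fun x y => x = y ∧ x ∈ M₀.carrier) M₁ M₂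

theorem IsSplitting.symm {M₀ M₁ M₂ : LStr L} (h : K.IsSplitting κ M₀ M₁ M₂) :
    K.IsSplitting κ M₀ M₂ M₁ :=
  ⟨h.right, h.left, fun H => h.not_amalgamates (by
    obtain ⟨P, g, g', hP, hg, hg', hr⟩ := H
    exact ⟨P, g', g, hP, hg', hg, fun x y hxy => (hr y x ⟨hxy.1.symm, hxy.1 ▸ hxy.2⟩).symm⟩)⟩

/-- If `M₁ = M₀`, then `M₂` itself is an amalgam. This is the source of proper extensions. -/
theorem IsSplitting.exists_notMem {M₀ M₁ M₂ : LStr L} (h : K.IsSplitting κ M₀ M₁ M₂) :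
    ∃ x ∈ M₁.carrier, x ∉ M₀.carrier := by
  by_contra! H
  obtain rfl := (K.isSub h.left.1).eq_of_subset H
  refine h.not_amalgamates ⟨M₂, _, _, ((K.ofCard κ).mem_of_le h.right).2, isEmb_of_le h.right.1,
    isEmb_of_le (K.le_refl (K.mem_of_le h.right.1).2), fun x y hxy => Subtype.ext hxy.1⟩

theorem exists_isSplitting (h : ¬ K.HasAmalgamation κ) : ∃ M₀ M₁ M₂, K.IsSplitting κ M₀ M₁ M₂ := by
  by_contra! H
  refine h fun M₀ M₁ M₂ h₁ h₂ => ?_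
  obtain ⟨N, f₁, f₂, hN, hf₁, hf₂, hf⟩ := not_not.1 fun h' => H M₀ M₁ M₂ ⟨h₁, h₂, h'⟩
  exact ⟨N, f₁, f₂, hN, hf₁, hf₂, fun x => hf _ _ ⟨rfl, x.2⟩⟩

section Ambient

variable {W : Type u} {o : W → ZFSet.{u}}

theorem exists_le_of_iso (hκ : ℵ₀ ≤ κ) (hW : #W = Order.succ κ) (ho : Function.Injective o)
    {M₀ M₁ U : LStr L} (h : (K.ofCard κ).Le M₀ M₁) (k : LStr.Iso M₀ U)
    (hU : ∀ x ∈ U.carrier, ∃ w, o w = x) :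
    ∃ (N : LStr L) (g : LStr.Iso M₁ N), (K.ofCard κ).Le U N ∧ (∀ x ∈ N.carrier, ∃ w, o w = x) ∧
      ∀ (x : M₁.carrier) (hx : (x : ZFSet.{u}) ∈ M₀.carrier),
        (g.toEquiv x : ZFSet.{u}) = k.toEquiv ⟨x, hx⟩ := by
  obtain ⟨N, g, hN, hg⟩ := LStr.exists_iso_range hκ hW ho h.2.2.le
    {x : M₁.carrier | (x : ZFSet.{u}) ∈ M₀.carrier} (fun x => (k.toEquiv ⟨x.1, x.2⟩ : ZFSet.{u}))
    (fun x y hxy => Subtype.ext (Subtype.ext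
      (Subtype.mk.inj (k.toEquiv.injective (Subtype.ext hxy)))))
    (fun x => hU _ (Subtype.prop _))
  exact ⟨N, g, ⟨le_of_iso h.1 g k fun x => (hg ⟨⟨x, _⟩, x.2⟩).symm, k.card_eq ▸ h.2.1,
    g.card_eq ▸ h.2.2⟩, hN, fun x hx => hg ⟨x, hx⟩⟩

variable [LinearOrder W]

/-- `s` is an increasing chain below `α`, of models in `K_κ` with universe in `range o`. -/
structure IsChainBelow (K : AbstractClass L) (κ : Cardinal.{u}) (o : W → ZFSet.{u}) (α : W)
    (s : W → LStr L) : Prop where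
  mem : ∀ β < α, (K.ofCard κ).Mem (s β)
  range : ∀ β < α, ∀ x ∈ (s β).carrier, ∃ w, o w = x
  le : ∀ γ β, γ < β → β < α → K.Le (s γ) (s β)

/-- `N` is a proper extension in `K_κ` of the chain `s` below `α`, with universe in `range o`. -/
structure IsProperExt (K : AbstractClass L) (κ : Cardinal.{u}) (o : W → ZFSet.{u}) (α : W)
    (s : W → LStr L) (N : LStr L) : Prop where
  mem : (K.ofCard κ).Mem N
  range : ∀ x ∈ N.carrier, ∃ w, o w = x
  le : ∀ β < α, K.Le (s β) N
  proper : ∃ x ∈ N.carrier, ∀ β < α, x ∉ (s β).carrier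

/-- Copy `M₁` over `U`. A point of `M₁` outside `M₀` lands outside `U`, hence outside the whole
chain. -/
theorem IsSplitting.exists_properExt (hκ : ℵ₀ ≤ κ) (hW : #W = Order.succ κ)
    (ho : Function.Injective o) {M₀ M₁ M₂ U : LStr L} (h : K.IsSplitting κ M₀ M₁ M₂)
    (k : LStr.Iso M₀ U) (hU : ∀ x ∈ U.carrier, ∃ w, o w = x) {α : W} {s : W → LStr L}
    (hs : ∀ β < α, K.Le (s β) U) :
    ∃ (N : LStr L) (g : LStr.Iso M₁ N), K.IsProperExt κ o α s N ∧
      ∀ (x : M₁.carrier) (hx : (x : ZFSet.{u}) ∈ M₀.carrier),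
        (g.toEquiv x : ZFSet.{u}) = k.toEquiv ⟨x, hx⟩ := by
  obtain ⟨N, g, hle, hN, hg⟩ := exists_le_of_iso hκ hW ho h.left k hU
  obtain ⟨x, hx, hx'⟩ := h.exists_notMem
  refine ⟨N, g, ⟨((K.ofCard κ).mem_of_le hle).2, hN, fun β hβ => K.le_trans (hs β hβ) hle.1,
    g.toEquiv ⟨x, hx⟩, Subtype.prop _, fun β hβ hmem => ?_⟩, hg⟩
  have hmemU := (K.isSub (hs β hβ)).subset _ hmem
  obtain ⟨y, hy⟩ := k.toEquiv.surjective ⟨_, hmemU⟩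
  have hyM := (K.isSub h.left.1).subset _ y.2
  have h1 := (hg ⟨y, hyM⟩ y.2).trans (congrArg Subtype.val hy)
  have h2 := g.toEquiv.injective (Subtype.ext h1)
  exact hx' ((Subtype.mk.inj h2) ▸ y.2)

/-- Move an upper bound into `range o`, fixing the chain pointwise. By categoricity it is isomorphic
to `M₀`, so it has a proper extension copied from `M₁`. -/
theorem IsChainBelow.exists_properExt (hκ : ℵ₀ ≤ κ) (hW : #W = Order.succ κ)
    (ho : Function.Injective o) (hcat : K.numModels κ = 1)
    {M₀ M₁ M₂ : LStr L} (h : K.IsSplitting κ M₀ M₁ M₂) {α : W} {s : W → LStr L}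
    (hs : K.IsChainBelow κ o α s)
    (hub : ∃ N, (K.ofCard κ).Mem N ∧ ∀ β < α, K.Le (s β) N) : ∃ N, K.IsProperExt κ o α s N := by
  obtain ⟨N, hN, hle⟩ := hub
  obtain ⟨U, g, hU, hg⟩ := LStr.exists_iso_range hκ hW ho hN.2.le
    {x : N.carrier | ∃ β < α, (x : ZFSet.{u}) ∈ (s β).carrier} (fun x => (x.1 : ZFSet.{u}))
    (fun x y hxy => Subtype.ext (Subtype.ext hxy))
    (fun x => by
      obtain ⟨β, hβ, hx⟩ := x.2
      exact hs.range β hβ _ hx)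
  have hUle : ∀ β < α, K.Le (s β) U := fun β hβ =>
    le_of_iso (hle β hβ) g (LStr.Iso.refl _) fun x => (hg ⟨⟨x, _⟩, β, hβ, x.2⟩).symm
  obtain ⟨k⟩ := nonempty_iso_of_numModels hcat ((K.ofCard κ).mem_of_le h.left).1
    ((K.ofCard κ).mem_of_iso g hN)
  obtain ⟨N', -, hN', -⟩ := h.exists_properExt hκ hW ho k hU hUle
  exact ⟨N', hN'⟩

/-- A splitting can be copied over an isomorphism between two models which bound chains. -/
theorem IsSplitting.exists_properExt_pair (hκ : ℵ₀ ≤ κ) (hW : #W = Order.succ κ)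
    (ho : Function.Injective o) (hcat : K.numModels κ = 1)
    {M₀ M₁ M₂ : LStr L} (h : K.IsSplitting κ M₀ M₁ M₂) {δ : W} {s s' : W → LStr L} {U U' : LStr L}
    (hUmem : (K.ofCard κ).Mem U)
    (hU : ∀ x ∈ U.carrier, ∃ w, o w = x) (hU' : ∀ x ∈ U'.carrier, ∃ w, o w = x)
    (hs : ∀ β < δ, K.Le (s β) U) (hs' : ∀ β < δ, K.Le (s' β) U') (e : LStr.Iso U U')
    {r : ZFSet.{u} → ZFSet.{u} → Prop} (hr : ∀ x : U.carrier, r x (e.toEquiv x)) :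
    ∃ N N', K.IsProperExt κ o δ s N ∧ K.IsProperExt κ o δ s' N' ∧
      ¬ K.AmalgamatesOver κ r N N' := by
  -- `N` copies `M₁` along `k`, and `N'` copies `M₂` along `k` followed by `e`. An amalgam
  -- identifying points along `e` would pull back to one of `M₁` and `M₂` over `M₀`.
  obtain ⟨k⟩ := nonempty_iso_of_numModels hcat ((K.ofCard κ).mem_of_le h.left).1 hUmem
  obtain ⟨N, g, hN, hg⟩ := h.exists_properExt hκ hW ho k hU hs
  obtain ⟨N', g', hN', hg'⟩ := h.symm.exists_properExt hκ hW ho (k.trans e) hU' hs'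
  refine ⟨N, N', hN, hN', fun ⟨P, f, f', hP, hf, hf', hff⟩ => h.not_amalgamates
    ⟨P, _, _, hP, hf.comp_iso g, hf'.comp_iso g', fun x y hxy => hff _ _ ?_⟩⟩
  obtain ⟨x, hx₁⟩ := x
  obtain ⟨y, hy₁⟩ := y
  obtain ⟨rfl, hx⟩ : x = y ∧ x ∈ M₀.carrier := hxy
  rw [hg ⟨x, hx₁⟩ hx, hg' ⟨x, hy₁⟩ hx]
  exact hr _

end Ambient

/-- Apply Löwenheim–Skolem–Tarski to the union of the two universes inside `V`; `κ ^< μ = κ` keeps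
the size at `κ`, and coherence puts `N` and `N'` below the result. -/
theorem IsMuAEC.exists_amalgam_le (hK : K.IsMuAEC) (hpow : κ = κ ^< μ) (hLS : K.LS ≤ κ)
    {V N N' : LStr L} (hN : K.Le N V) (hN' : K.Le N' V) (hNc : N.card = κ) (hNc' : N'.card = κ) :
    ∃ P, (K.ofCard κ).Mem P ∧ K.Le N P ∧ K.Le N' P := by
  obtain ⟨h1, h2, h3⟩ := csInf_mem (s := {κ | K.IsLST κ}) hK.lst
  have hκ : ℵ₀ ≤ κ := hK.regular.aleph0_le.trans ((self_le_add_left _ _).trans (h2.trans hLS))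
  obtain ⟨P, hP, hsub, hcard⟩ := h3 V (K.mem_of_le hN).2 (N.carrier ∪ N'.carrier) (fun x hx => by
    rcases ZFSet.mem_union.1 hx with hx | hx
    exacts [(K.isSub hN).subset x hx, (K.isSub hN').subset x hx])
  have hsubN : N.IsSub P := by
    refine (K.isSub hN).of_isSub (K.isSub hP) fun x hx => hsub (ZFSet.mem_union.2 (Or.inl hx))
  have hsubN' : N'.IsSub P := by
    refine (K.isSub hN').of_isSub (K.isSub hP) fun x hx => hsub (ZFSet.mem_union.2 (Or.inr hx))
  refine ⟨P, ⟨(K.mem_of_le hP).1, le_antisymm ?_ (hNc ▸ hsubN.card_le)⟩,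
    hK.coherence hN hP hsubN, hK.coherence hN' hP hsubN'⟩
  have hA : (N.carrier ∪ N'.carrier).card ≤ κ :=
    ZFSet.card_union_le.trans (add_le_of_le hκ hNc.le hNc'.le)
  refine hcard.trans (add_le_of_le hκ (powerlt_le.2 fun c hc => ?_) hLS)
  exact (power_le_power_right hA).trans ((le_powerlt κ hc).trans hpow.symm.le)

end AbstractClass

/-! ### Chains steered by guesses, and their unions -/

namespace AbstractClass

variable {μ : Cardinal.{u}} {L : MuLanguage μ} {K : AbstractClass L} {κ : Cardinal.{u}}
  {W : Type u} {o : W → ZFSet.{u}} [LinearOrder W]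

/-- There are chains `M η`, `η : W → Bool`, such that whenever `G` guesses at `δ` two different
chains and a map for which proper extensions without amalgam exist, such extensions are chosen. -/
theorem exists_runs [WellFoundedLT W] (K : AbstractClass L) (hκ : ℵ₀ ≤ κ) (hW : #W = Order.succ κ)
    (ho : Function.Injective o) (hcat : K.numModels κ = 1)
    {M₀ M₁ M₂ : LStr L} (h : K.IsSplitting κ M₀ M₁ M₂)
    (hub : ∀ (α : W) (s : W → LStr L), K.IsChainBelow κ o α s →
      ∃ N, (K.ofCard κ).Mem N ∧ ∀ β < α, K.Le (s β) N)
    (b b' : W → W → Bool) (s s' : W → W → LStr L) (r : W → ZFSet.{u} → ZFSet.{u} → Prop) :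
    ∃ M : (W → Bool) → W → LStr L, (∀ η α, K.IsProperExt κ o α (M η) (M η α)) ∧
      ∀ η ν δ, (∃ w < δ, η w ≠ ν w) →
        (∀ β < δ, b δ β = η β ∧ s δ β = M η β) → (∀ β < δ, b' δ β = ν β ∧ s' δ β = M ν β) →
        (∃ N N', K.IsProperExt κ o δ (M η) N ∧ K.IsProperExt κ o δ (M ν) N' ∧
          ¬ K.AmalgamatesOver κ (r δ) N N') →
        ¬ K.AmalgamatesOver κ (r δ) (M η δ) (M ν δ) := by
  classical
  let Good : W → LStr L × LStr L → Prop := fun δ p => K.IsProperExt κ o δ (s δ) p.1 ∧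
    K.IsProperExt κ o δ (s' δ) p.2 ∧ ¬ K.AmalgamatesOver κ (r δ) p.1 p.2
  have hgood : ∀ δ, ∃ p, (∃ q, Good δ q) → Good δ p := fun δ => by
    by_cases H : ∃ q, Good δ q
    · exact ⟨H.choose, fun _ => H.choose_spec⟩
    · exact ⟨(M₀, M₀), fun H' => absurd H' H⟩
  choose p hp using hgood
  have : Nonempty (LStr L) := ⟨M₀⟩
  have hcongr : ∀ (α : W) (t t' : W → LStr L) N, (∀ β < α, t β = t' β) →
      K.IsProperExt κ o α t N → K.IsProperExt κ o α t' N := fun α t t' N htt hN =>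
    ⟨hN.mem, hN.range, fun β hβ => htt β hβ ▸ hN.le β hβ, by
      obtain ⟨x, hx, hx'⟩ := hN.proper
      exact ⟨x, hx, fun β hβ => htt β hβ ▸ hx' β hβ⟩⟩
  -- Each run is built separately: runs of branches with a common initial segment need not agree
  -- there, since the chains themselves are guessed too. The first guess takes precedence when both
  -- fit.
  have hrun : ∀ η : W → Bool, ∃ t : W → LStr L, ∀ α, K.IsProperExt κ o α t (t α) ∧
      ((∃ q, Good α q) → ((∀ β < α, b α β = η β ∧ s α β = t β) → t α = (p α).1) ∧
        (¬ (∀ β < α, b α β = η β ∧ s α β = t β) →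
          (∀ β < α, b' α β = η β ∧ s' α β = t β) → t α = (p α).2)) := fun η => by
    refine exists_forall_of_wellFounded (fun α t N => K.IsProperExt κ o α t N ∧
      ((∃ q, Good α q) → ((∀ β < α, b α β = η β ∧ s α β = t β) → N = (p α).1) ∧
        (¬ (∀ β < α, b α β = η β ∧ s α β = t β) →
          (∀ β < α, b' α β = η β ∧ s' α β = t β) → N = (p α).2))) ?_ ?_
    · rintro α t t' N htt ⟨hN, hN'⟩
      have h1 : (∀ β < α, b α β = η β ∧ s α β = t β) ↔ ∀ β < α, b α β = η β ∧ s α β = t' β :=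
        forall₂_congr fun β hβ => by rw [htt β hβ]
      have h2 : (∀ β < α, b' α β = η β ∧ s' α β = t β) ↔ ∀ β < α, b' α β = η β ∧ s' α β = t' β :=
        forall₂_congr fun β hβ => by rw [htt β hβ]
      rw [h1, h2] at hN'
      exact ⟨hcongr α t t' N htt hN, hN'⟩
    · intro α t ht
      have hchain : K.IsChainBelow κ o α t :=
        ⟨fun β hβ => (ht β hβ).1.mem, fun β hβ => (ht β hβ).1.range,
          fun γ β hγ hβ => (ht β hβ).1.le γ hγ⟩
      obtain ⟨N, hN⟩ := hchain.exists_properExt hκ hW ho hcat h (hub α t hchain)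
      by_cases hq : ∃ q, Good α q
      · by_cases h1 : ∀ β < α, b α β = η β ∧ s α β = t β
        · exact ⟨(p α).1, hcongr α _ _ _ (fun β hβ => (h1 β hβ).2) (hp α hq).1,
            fun _ => ⟨fun _ => rfl, fun h => absurd h1 h⟩⟩
        · by_cases h2 : ∀ β < α, b' α β = η β ∧ s' α β = t β
          · exact ⟨(p α).2, hcongr α _ _ _ (fun β hβ => (h2 β hβ).2) (hp α hq).2.1,
              fun _ => ⟨fun h => absurd h h1, fun _ _ => rfl⟩⟩
          · exact ⟨N, hN, fun _ => ⟨fun h => absurd h h1, fun _ h => absurd h h2⟩⟩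
      · exact ⟨N, hN, fun h => absurd h hq⟩
  choose M hM using hrun
  refine ⟨M, fun η α => (hM η α).1, fun η ν δ ⟨w, hw, hne⟩ h1 h2 ⟨N, N', hN, hN', hNN⟩ => ?_⟩
  have hq : ∃ q, Good δ q := ⟨(N, N'), hcongr δ _ _ _ (fun β hβ => (h1 β hβ).2.symm) hN,
    hcongr δ _ _ _ (fun β hβ => (h2 β hβ).2.symm) hN', hNN⟩
  -- The branches differ at `w < δ`, so `ν` does not match the first guess and takes the second
  -- component.
  rw [((hM η δ).2 hq).1 h1, ((hM ν δ).2 hq).2 (fun h3 => hne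
    ((h1 w hw).1.symm.trans (h3 w hw).1)) h2]
  exact (hp δ hq).2.2

/-- The union of the initial segments of a chain, at a point `δ` such that the initial segment of
`δ` is `μ`-directed. -/
theorem IsMuAEC.exists_iUnion_Iio (hK : K.IsMuAEC) (hκ : ℵ₀ ≤ κ) (hI : ∀ a : W, #(Set.Iio a) ≤ κ)
    {M : W → LStr L} (hM : ∀ α, (K.ofCard κ).Mem (M α)) (hle : ∀ β α, β < α → K.Le (M β) (M α))
    {δ : W} (hδ : IsMuDirected μ (Set.Iio δ)) {V : LStr L} (hV : ∀ α, K.Le (M α) V) :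
    ∃ U, (K.ofCard κ).Mem U ∧ (∀ β < δ, K.Le (M β) U) ∧ K.Le U V ∧
      ∀ x, x ∈ U.carrier ↔ ∃ β < δ, x ∈ (M β).carrier := by
  obtain ⟨U, hU, hUK, hUle, hUV⟩ := hK.tarski_vaught (Set.Iio δ) hδ (fun i => M i)
    (fun i => (hM i).1) (fun i j hij => hle i j hij)
  -- Directedness applied to the empty set: `δ` is not the least point, so the union contains some
  -- `M β` and has size at least `κ`.
  obtain ⟨⟨β, hβ⟩, -⟩ := hδ ∅ (by simpa using hK.regular.pos)
  have hmem : ∀ x, x ∈ U.carrier ↔ ∃ β < δ, x ∈ (M β).carrier := fun x => by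
    rw [hU.mem_iff]
    exact ⟨fun ⟨i, hi⟩ => ⟨i, i.2, hi⟩, fun ⟨β, hβ, h⟩ => ⟨⟨β, hβ⟩, h⟩⟩
  refine ⟨U, ⟨hUK, le_antisymm ?_ ?_⟩, fun β hβ => hUle ⟨β, hβ⟩,
    hUV V (K.mem_of_le (hV β)).2 fun i => hV i, hmem⟩
  · have hsub : U.carrier ⊆ ZFSet.iUnion fun i : Set.Iio δ => (M i).carrier := fun x hx => by
      obtain ⟨β, hβ, hx⟩ := (hmem x).1 hx
      exact ZFSet.mem_iUnion.2 ⟨⟨β, hβ⟩, hx⟩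
    refine (ZFSet.card_mono hsub).trans ?_
    have h1 := ZFSet.lift_card_iUnion_le_sum_card (f := fun i : Set.Iio δ => (M i).carrier)
    rw [Cardinal.lift_id] at h1
    refine h1.trans ((sum_le_mk_mul_iSup _).trans ?_)
    exact (mul_le_mul' (hI δ) (ciSup_le' fun i : Set.Iio δ => (hM i.1).2.le)).trans
      (mul_eq_self hκ).le
  · exact (hM β).2.symm.le.trans (K.isSub (hUle ⟨β, hβ⟩)).card_le

/-- The union of a properly increasing chain of length `κ⁺`. -/
theorem IsMuAEC.exists_iUnion (hK : K.IsMuAEC) (hdir : IsMuDirected μ W)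
    (hW : #W = Order.succ κ)
    {M : W → LStr L} (hM : ∀ α, K.IsProperExt κ o α M (M α)) :
    ∃ V, (K.ofCard (Order.succ κ)).Mem V ∧ (∀ α, K.Le (M α) V) ∧
      (∀ x, x ∈ V.carrier ↔ ∃ α, x ∈ (M α).carrier) ∧ ∀ x ∈ V.carrier, ∃ w, o w = x := by
  obtain ⟨V, hV, hVK, hVle, -⟩ := hK.tarski_vaught W hdir M (fun α => (hM α).mem.1)
    (fun α β hαβ => (hM β).le α hαβ)
  have hrange : ∀ x ∈ V.carrier, ∃ w, o w = x := fun x hx => by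
    obtain ⟨α, hα⟩ := (hV.mem_iff x).1 hx
    exact (hM α).range x hα
  refine ⟨V, ⟨hVK, le_antisymm ?_ ?_⟩, hVle, hV.mem_iff, hrange⟩
  · have hsub : V.carrier ⊆ ZFSet.range o := fun x hx => ZFSet.mem_range.2 (hrange x hx)
    refine (ZFSet.card_mono hsub).trans ?_
    have h1 := ZFSet.lift_card_range_le (f := o)
    rwa [Cardinal.lift_id, Cardinal.lift_id, hW] at h1
  -- A new point at every stage gives an injection of `W` into the union.
  · choose x hx hx' using fun α => (hM α).proper
    rw [← hW, ← Cardinal.lift_le.{u + 1}, ← LStr.mk_carrier,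
      ← Cardinal.lift_id'.{u, u + 1} #V.carrier]
    refine Cardinal.lift_mk_le_lift_mk_of_injective (f := fun α =>
      (⟨x α, (K.isSub (hVle α)).subset _ (hx α)⟩ : V.carrier)) ?_
    intro α β hαβ
    have hxy : x α = x β := Subtype.mk.inj hαβ
    rcases lt_trichotomy α β with h | h | h
    · exact absurd (hxy ▸ hx α) (hx' β α h)
    · exact h
    · exact absurd (hxy ▸ hx β) (hx' α β h)

end AbstractClass

/-! ### Different branches give non-isomorphic models -/

namespace AbstractClass

variable {μ : Cardinal.{u}} {L : MuLanguage μ} {K : AbstractClass L} {κ : Cardinal.{u}}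

theorem exists_upperBound_of_chainExtension
    (hchain : ∀ δ : Ordinal.{u}, δ < (Order.succ κ).ord → (K.ofCard κ).ChainExtension δ)
    {o : (Order.succ κ).ord.ToType → ZFSet.{u}} (α : (Order.succ κ).ord.ToType)
    (s : (Order.succ κ).ord.ToType → LStr L) (hs : K.IsChainBelow κ o α s) :
    ∃ N, (K.ofCard κ).Mem N ∧ ∀ β < α, K.Le (s β) N := by
  have hα := (Ordinal.ToType.mk.symm α).2
  let t : Set.Iio (Ordinal.ToType.mk.symm α).1 → (Order.succ κ).ord.ToType :=
    fun i => Ordinal.ToType.mk ⟨i, Set.mem_Iio.2 (lt_trans (Set.mem_Iio.1 i.2) hα)⟩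
  have ht : ∀ i, t i < α := fun i => by
    rw [← Ordinal.ToType.mk.symm.lt_iff_lt, OrderIso.symm_apply_apply]
    exact i.2
  have htm : ∀ i j, i < j → t i < t j := fun i j hij => Ordinal.ToType.mk.lt_iff_lt.2 hij
  obtain ⟨N, hN, hle⟩ := hchain _ hα (fun i => s (t i)) (fun i => hs.mem _ (ht i)) fun i j hij =>
    ⟨hs.le _ _ (htm i j hij) (ht j), (hs.mem _ (ht i)).2, (hs.mem _ (ht j)).2⟩
  refine ⟨N, hN, fun β hβ => ?_⟩
  have h1 := (hle ⟨(Ordinal.ToType.mk.symm β).1, Ordinal.ToType.mk.symm.lt_iff_lt.2 hβ⟩).1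
  have h2 : t ⟨(Ordinal.ToType.mk.symm β).1, Ordinal.ToType.mk.symm.lt_iff_lt.2 hβ⟩ = β :=
    Ordinal.ToType.mk.apply_symm_apply β
  rwa [h2] at h1

/-- The image of `N` under `F` and `N'` lie in the common extension `V'`, and `r` identifies points
only along the graph of `F`. -/
theorem IsMuAEC.amalgamatesOver_of_iso (hK : K.IsMuAEC) (hpow : κ = κ ^< μ) (hLS : K.LS ≤ κ)
    {V V' N N' : LStr L} (F : LStr.Iso V V') (hN : K.Le N V) (hN' : K.Le N' V')
    (hNc : N.card = κ) (hNc' : N'.card = κ) {r : ZFSet.{u} → ZFSet.{u} → Prop}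
    (hr : ∀ (x : V.carrier) y, r x y → y = F.toEquiv x) : K.AmalgamatesOver κ r N N' := by
  obtain ⟨N₁, himg, hN₁⟩ := K.image_le F hN
  obtain ⟨g, hg⟩ := F.exists_restrict (K.isSub hN) (K.isSub hN₁) himg
  obtain ⟨P, hP, hle, hle'⟩ := hK.exists_amalgam_le hpow hLS hN₁ hN' (g.card_eq ▸ hNc) hNc'
  refine ⟨P, _, _, hP, (isEmb_of_le hle).comp_iso g, isEmb_of_le hle', fun x y hxy =>
    Subtype.ext ?_⟩
  exact (hg x).trans (hr ⟨x, (K.isSub hN).subset _ x.2⟩ y hxy).symm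

theorem IsMuAEC.exists_not_iso (hK : K.IsMuAEC) (hpow : κ = κ ^< μ)
    (hLS : K.LS ≤ κ) (hcat : K.numModels κ = 1)
    (hchain : ∀ δ : Ordinal.{u}, δ < (Order.succ κ).ord → (K.ofCard κ).ChainExtension δ)
    (hmu : κ = κ ^ μ) (hch : (2 : Cardinal.{u}) ^ κ = Order.succ κ) (h : ¬ K.HasAmalgamation κ) :
    ∃ V : ((Order.succ κ).ord.ToType → Bool) → LStr L,
      (∀ η, (K.ofCard (Order.succ κ)).Mem (V η)) ∧
      ∀ η ν, η ≠ ν → IsEmpty (LStr.Iso (V η) (V ν)) := by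
  have hμκ : μ ≤ κ :=
    (self_le_add_left _ _).trans ((csInf_mem (s := {κ | K.IsLST κ}) hK.lst).2.1.trans hLS)
  have hμ := hK.regular
  have hκ : ℵ₀ ≤ κ := hμ.aleph0_le.trans hμκ
  let W := (Order.succ κ).ord.ToType
  have hW : #W = Order.succ κ := mk_ord_toType _
  have hI : ∀ a : W, #(Set.Iio a) ≤ κ := fun a => Order.lt_succ_iff.1
    ((mk_Iio_lt a (by simp [W])).trans_eq hW)
  have hb : ∀ s : Set W, #s ≤ κ → ∃ b, ∀ x ∈ s, x < b := fun s hs =>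
    (isRegular_succ hκ).exists_forall_lt s (Order.lt_succ_of_le hs)
  have hdirW : IsMuDirected μ W := fun J hJ => by
    obtain ⟨b, hb⟩ := hb J (hJ.le.trans hμκ)
    exact ⟨b, fun x hx => (hb x hx).le⟩
  -- All models are built on sets of ordinals below `κ⁺`, so a guessed chain can be literally equal
  -- to the constructed one.
  let o : W → ZFSet.{u} := fun w => (Ordinal.ToType.mk.symm w).1.toZFSet
  have ho : Function.Injective o := fun x y hxy =>
    Ordinal.ToType.mk.symm.injective (Subtype.ext (Ordinal.toZFSet_injective hxy))
  obtain ⟨M₀, M₁, M₂, hsplit⟩ := exists_isSplitting h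
  obtain ⟨dec, hdec⟩ := exists_decoding hcat o ((K.ofCard κ).mem_of_le hsplit.left).1
  have : Nonempty W := by
    obtain ⟨b, -⟩ := hb ∅ (by simp)
    exact ⟨b⟩
  have hT : #(Bool × Bool × (κ.ord.ToType → W) × (κ.ord.ToType → W) × W) ≤ Order.succ κ := by
    have hs : ℵ₀ ≤ Order.succ κ := hκ.trans (Order.le_succ κ)
    have h1 : #(κ.ord.ToType → W) ≤ Order.succ κ := by
      rw [← power_def, hW, mk_ord_toType, ← hch, ← power_mul, mul_eq_self hκ]
    have h2 : (2 : Cardinal.{u}) ≤ Order.succ κ := by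
      simpa using (natCast_lt_aleph0 (n := 2)).le.trans hs
    simp only [mk_prod, Cardinal.lift_id, Cardinal.lift_uzero, mk_bool, Cardinal.lift_ofNat]
    exact mul_le_of_le hs h2 (mul_le_of_le hs h2 (mul_le_of_le hs h1 (mul_le_of_le hs h1 hW.le)))
  obtain ⟨G, hG⟩ := exists_diamond hμ hμκ hmu.symm hch hb hI hW hT
  obtain ⟨M, hM, hMG⟩ := exists_runs K hκ hW ho hcat hsplit
    (exists_upperBound_of_chainExtension hchain)
    (fun δ β => (G δ β).1) (fun δ β => (G δ β).2.1) (fun δ β => dec (G δ β).2.2.1)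
    (fun δ β => dec (G δ β).2.2.2.1)
    (fun δ x y => ∃ a < δ, x = o a ∧ y = o (G δ a).2.2.2.2)
  choose V hV hMV hVmem hVo using fun η => hK.exists_iUnion hdirW hW (hM η)
  refine ⟨V, hV, fun η ν hne => ⟨fun F => ?_⟩⟩
  obtain ⟨w₀, hw₀⟩ := Function.ne_iff.1 hne
  choose c hc using fun η α => hdec (M η α) (hM η α).mem (hM η α).range
  have hfwd : ∀ a, ∃ b, ∀ ha : o a ∈ (V η).carrier, o b = F.toEquiv ⟨o a, ha⟩ := fun a => by
    by_cases ha : o a ∈ (V η).carrier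
    · obtain ⟨b, hb⟩ := hVo ν _ (F.toEquiv ⟨o a, ha⟩).2
      exact ⟨b, fun _ => hb⟩
    · exact ⟨a, fun h => absurd h ha⟩
  have hbwd : ∀ a, ∃ b, ∀ ha : o a ∈ (V ν).carrier, o b = F.toEquiv.symm ⟨o a, ha⟩ := fun a => by
    by_cases ha : o a ∈ (V ν).carrier
    · obtain ⟨b, hb⟩ := hVo η _ (F.toEquiv.symm ⟨o a, ha⟩).2
      exact ⟨b, fun _ => hb⟩
    · exact ⟨a, fun h => absurd h ha⟩
  have hstage : ∀ θ a, ∃ b, o a ∈ (V θ).carrier → o a ∈ (M θ b).carrier := fun θ a => by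
    by_cases ha : o a ∈ (V θ).carrier
    · obtain ⟨b, hb⟩ := (hVmem θ _).1 ha
      exact ⟨b, fun _ => hb⟩
    · exact ⟨a, fun h => absurd h ha⟩
  have hbound : ∀ θ β, ∃ b, ∀ a, o a ∈ (M θ β).carrier → a < b := fun θ β => by
    obtain ⟨b, hb⟩ := hb {a | o a ∈ (M θ β).carrier} (by
      rw [← Cardinal.lift_le.{u + 1}, ← (hM θ β).mem.2, ← LStr.mk_carrier,
        ← Cardinal.lift_id'.{u, u + 1} #(M θ β).carrier]
      exact Cardinal.lift_mk_le_lift_mk_of_injective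
        (f := fun a : {a | o a ∈ (M θ β).carrier} => (⟨o a, a.2⟩ : (M θ β).carrier))
        fun x y hxy => Subtype.ext (ho (Subtype.mk.inj hxy)))
    exact ⟨b, fun a ha => hb a ha⟩
  choose f hf using hfwd
  choose f' hf' using hbwd
  choose t ht using hstage
  choose t' ht' using hbound
  -- Closure under `t` and `t'` makes the union of each chain below `δ` the part of `V η` or `V ν`
  -- lying in `o` of the points below `δ`. Closure under `f` and `f'` makes `F` map one part onto
  -- the other, and `w₀` puts a difference of the branches below `δ`.
  obtain ⟨δ, hδ, hcl, hguess⟩ := hG (fun β => (η β, ν β, c η β, c ν β, f β))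
    (fun β => max (max (max (f β) (f' β)) (max (t η β) (t ν β)))
      (max (max (t' η β) (t' ν β)) w₀))
  simp only [max_lt_iff] at hcl
  have hw₀δ : w₀ < δ := by
    obtain ⟨⟨β, hβ⟩, -⟩ := hδ ∅ (by simpa using hμ.pos)
    exact (hcl β hβ).2.2
  have hle : ∀ θ β α, β < α → K.Le (M θ β) (M θ α) := fun θ β α hβ => (hM θ α).le β hβ
  obtain ⟨U, hU, hMU, hUV, hUmem⟩ :=
    hK.exists_iUnion_Iio hκ hI (fun α => (hM η α).mem) (hle η) hδ (hMV η)
  obtain ⟨U', -, hMU', hUV', hUmem'⟩ :=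
    hK.exists_iUnion_Iio hκ hI (fun α => (hM ν α).mem) (hle ν) hδ (hMV ν)
  have hUiff : ∀ x, x ∈ U.carrier ↔ ∃ a < δ, o a = x ∧ x ∈ (V η).carrier := fun x => by
    rw [hUmem]
    constructor
    · rintro ⟨β, hβ, hx⟩
      obtain ⟨a, rfl⟩ := (hM η β).range x hx
      exact ⟨a, (ht' η β a hx).trans (hcl β hβ).2.1.1, rfl, (hVmem η _).2 ⟨β, hx⟩⟩
    · rintro ⟨a, ha, rfl, hx⟩
      exact ⟨t η a, (hcl a ha).1.2.1, ht η a hx⟩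
  have hUiff' : ∀ x, x ∈ U'.carrier ↔ ∃ a < δ, o a = x ∧ x ∈ (V ν).carrier := fun x => by
    rw [hUmem']
    constructor
    · rintro ⟨β, hβ, hx⟩
      obtain ⟨a, rfl⟩ := (hM ν β).range x hx
      exact ⟨a, (ht' ν β a hx).trans (hcl β hβ).2.1.2, rfl, (hVmem ν _).2 ⟨β, hx⟩⟩
    · rintro ⟨a, ha, rfl, hx⟩
      exact ⟨t ν a, (hcl a ha).1.2.2, ht ν a hx⟩
  have himg : LStr.IsImage F U U' := fun y => by
    constructor
    · intro hy
      obtain ⟨a, ha, rfl, hyV⟩ := (hUiff' y).1 hy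
      exact ⟨F.toEquiv.symm ⟨o a, hyV⟩, (hUiff _).2 ⟨f' a, (hcl a ha).1.1.2, hf' a hyV,
        Subtype.prop _⟩, by rw [Equiv.apply_symm_apply]⟩
    · rintro ⟨⟨x, hxV⟩, hx, rfl⟩
      obtain ⟨a, ha, rfl, -⟩ := (hUiff x).1 hx
      exact (hUiff' _).2 ⟨f a, (hcl a ha).1.1.1, hf a hxV, Subtype.prop _⟩
  obtain ⟨e, he⟩ := F.exists_restrict (K.isSub hUV) (K.isSub hUV') himg
  refine hMG η ν δ ⟨w₀, hw₀δ, hw₀⟩ (fun β hβ => ?_) (fun β hβ => ?_) ?_ ?_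
  · rw [hguess β hβ]
    exact ⟨rfl, hc η β⟩
  · rw [hguess β hβ]
    exact ⟨rfl, hc ν β⟩
  · refine hsplit.exists_properExt_pair hκ hW ho hcat hU
      (fun x hx => hVo η x ((K.isSub hUV).subset x hx))
      (fun x hx => hVo ν x ((K.isSub hUV').subset x hx)) hMU hMU' e fun x => ?_
    obtain ⟨x, hx⟩ := x
    obtain ⟨a, ha, rfl, hxV⟩ := (hUiff x).1 hx
    refine ⟨a, ha, rfl, ?_⟩
    rw [hguess a ha, he]
    exact (hf a hxV).symm
  · refine hK.amalgamatesOver_of_iso hpow hLS F (hMV η δ) (hMV ν δ) (hM η δ).mem.2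
      (hM ν δ).mem.2 ?_
    rintro ⟨x, hx⟩ y ⟨a, ha, rfl, rfl⟩
    rw [hguess a ha]
    exact hf a hx

end AbstractClass

/-! ### Counting the models -/

theorem theorem6p9 {μ : Cardinal.{u}} (hμ : μ.IsRegular) (L : MuLanguage μ)
    (K : AbstractClass L) (hK : K.IsMuAEC) (κ : Cardinal.{u})
    (hpow : κ = κ ^< μ) (hLS : K.LS ≤ κ)
    (hcat : K.numModels κ = 1)
    (hone : 1 ≤ K.numModels (Order.succ κ))
    (hfew : K.numModels (Order.succ κ) < Cardinal.lift.{u + 1} (2 ^ Order.succ κ))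
    (hchain : ∀ δ : Ordinal.{u}, δ < (Order.succ κ).ord → (K.ofCard κ).ChainExtension δ)
    (hmu : κ = κ ^ μ) (hch : (2 : Cardinal.{u}) ^ κ = Order.succ κ) :
    K.HasAmalgamation κ := by
  by_contra h
  obtain ⟨V, hV, hne⟩ := hK.exists_not_iso hpow hLS hcat hchain hmu hch h
  refine hfew.not_ge ?_
  have hcard : #((Order.succ κ).ord.ToType → Bool) = 2 ^ Order.succ κ := by
    simp
  rw [← hcard, AbstractClass.numModels,
    ← Cardinal.lift_id'.{u, u + 1} #(Quotient (K.isoSetoid (Order.succ κ)))]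
  refine Cardinal.lift_mk_le_lift_mk_of_injective
    (f := fun η => Quotient.mk (K.isoSetoid (Order.succ κ)) ⟨V η, hV η⟩) fun η ν hην => ?_
  by_contra hηne
  obtain ⟨F⟩ := Quotient.exact hην
  exact (hne η ν hηne).false F
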